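/- Let $\mathcal{M}$ be a model category. For objects $A, X$ of $\mathcal{M}$, the homotopy mapping space $\underline{\mathrm{Ho}\,\mathcal{M}}(A,X) \in \mathrm{Ho}(\mathbf{sSet})$ (Kan–Quillen model structure) is represented by the simplicial set $n \mapsto \mathrm{Hom}_{\mathcal{M}}(Q^n, RX)$, where $Q^\bullet$ is a Reedy cofibrant replacement of the constant cosimplicial object on $A$ and $RX$ is a fibrant replacement of $X$; it is functorial in $A$. Let $S$ be a class of morphisms of $\mathcal{M}$. An object $X$ is *$S$-local* if for every $f : A \to B$ in $S$ the map $f^* : \underline{\mathrm{Ho}\,\mathcal{M}}(B,X) \to \underline{\mathrm{Ho}\,\mathcal{M}}(A,X)$ is an isomorphism in $\mathrm{Ho}(\mathbf{sSet})$. A morphism $f : A \to B$ of $\mathcal{M}$ is an *$S$-equivalence* if $f^*$ is an isomorphism for every $S$-local object $X$. A model structure on the underlying category of $\mathcal{M}$ is the *(left Bousfield) localisation $L_S\mathcal{M}$ of $\mathcal{M}$ with respect to $S$* if it has the same cofibrations as $\mathcal{M}$, each weak equivalence of $\mathcal{M}$ is one of its weak equivalences, its fibrant objects are exactly the fibrant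 objects of $\mathcal{M}$ that are $S$-local, and its weak equivalences are exactly the $S$-equivalences. **Proposition.** Let $\mathcal{M}$ be a model category and let $S, T$ be two classes of morphisms of $\mathcal{M}$. Suppose that the localisations $L_S\mathcal{M}$, $L_T\mathcal{M}$, $L_T L_S\mathcal{M}$, $L_S L_T\mathcal{M}$ and $L_{S\cup T}\mathcal{M}$ exist. Then the model structures $L_T L_S\mathcal{M}$, $L_S L_T\mathcal{M}$ and $L_{S \cup T}\mathcal{M}$ are equal, i.e. they have the same cofibrations, the same weak equivalences and the same fibrations. -/

import Mathlib

open CategoryTheory CategoryTheory.Limits HomotopicalAlgebra Simplicial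

universe v u

namespace BousfieldLocalisation

/-! ### The homotopy category of simplicial sets -/

/-- The weak equivalences of the Kan-Quillen model structure on simplicial sets: the maps
that factor as an anodyne extension (left lifting property against all Kan fibrations) followed
by a trivial Kan fibration (right lifting property against all boundary inclusions). -/
def kanQuillenWeakEquivalences : MorphismProperty SSet.{v} := fun X Y f =>
  ∃ (Z : SSet.{v}) (i : X ⟶ Z) (p : Z ⟶ Y),
    SSet.modelCategoryQuillen.J.{v}.rlp.llp i ∧ SSet.modelCategoryQuillen.I.{v}.rlp p ∧ i ≫ p = f

/-- `Ho(SSet)`, for the Kan-Quillen model structure. -/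
abbrev HoSSet : Type (v + 1) := (kanQuillenWeakEquivalences.{v}).Localization

/-- The localisation functor `SSet ⥤ Ho(SSet)`. -/
abbrev toHoSSet : SSet.{v} ⥤ HoSSet.{v} := (kanQuillenWeakEquivalences.{v}).Q

/-! ### Latching and matching objects of cosimplicial objects -/

lemma finite_objects_of_len_lt (n : ℕ) : Finite {k : SimplexCategory // k.len < n} :=
  Finite.of_injective (fun k => (⟨k.1.len, k.2⟩ : Fin n)) (by
    intro a b h
    apply Subtype.ext
    apply SimplexCategory.ext
    simpa using h)

/-- The objects over `⦋n⦌` given by an injection `⦋k⦌ ⟶ ⦋n⦌` with `k < n`. -/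
def isLatchingIndex (n : ℕ) : ObjectProperty (Over ⦋n⦌) :=
  fun k => Mono k.hom ∧ k.left.len < n

/-- The latching category of `⦋n⦌`. -/
abbrev LatchingIndex (n : ℕ) : Type := (isLatchingIndex n).FullSubcategory

/-- The objects under `⦋n⦌` given by a surjection `⦋n⦌ ⟶ ⦋k⦌` with `k < n`. -/
def isMatchingIndex (n : ℕ) : ObjectProperty (Under ⦋n⦌) :=
  fun k => Epi k.hom ∧ k.right.len < n

/-- The matching category of `⦋n⦌`. -/
abbrev MatchingIndex (n : ℕ) : Type := (isMatchingIndex n).FullSubcategory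

noncomputable instance (n : ℕ) : FinCategory (LatchingIndex n) where
  fintypeObj := by
    have := finite_objects_of_len_lt n
    have : Finite (LatchingIndex n) :=
      Finite.of_injective
        (fun k => (⟨⟨k.obj.left, k.property.2⟩, k.obj.hom⟩ :
          Σ a : {a : SimplexCategory // a.len < n}, (a.1 ⟶ ⦋n⦌))) (by
        rintro ⟨⟨l, ⟨⟨⟩⟩, h⟩, hp⟩ ⟨⟨l', ⟨⟨⟩⟩, h'⟩, hp'⟩ e
        simp only [Sigma.mk.injEq, Subtype.mk.injEq] at e
        obtain ⟨e₁, e₂⟩ := e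
        subst e₁
        simp only [heq_eq_eq] at e₂
        subst e₂
        rfl)
    exact Fintype.ofFinite _
  fintypeHom a b := by
    have : Finite (a ⟶ b) :=
      Finite.of_injective (fun f => (f.hom.left : a.obj.left ⟶ b.obj.left)) (by
        intro f g h
        apply ObjectProperty.hom_ext
        exact Over.OverMorphism.ext h)
    exact Fintype.ofFinite _

noncomputable instance (n : ℕ) : FinCategory (MatchingIndex n) where
  fintypeObj := by
    have := finite_objects_of_len_lt n
    have : Finite (MatchingIndex n) :=
      Finite.of_injective
        (fun k => (⟨⟨k.obj.right, k.property.2⟩, k.obj.hom⟩ :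
          Σ a : {a : SimplexCategory // a.len < n}, (⦋n⦌ ⟶ a.1))) (by
        rintro ⟨⟨⟨⟨⟩⟩, l, h⟩, hp⟩ ⟨⟨⟨⟨⟩⟩, l', h'⟩, hp'⟩ e
        simp only [Sigma.mk.injEq, Subtype.mk.injEq] at e
        obtain ⟨e₁, e₂⟩ := e
        subst e₁
        simp only [heq_eq_eq] at e₂
        subst e₂
        rfl)
    exact Fintype.ofFinite _
  fintypeHom a b := by
    have : Finite (a ⟶ b) :=
      Finite.of_injective (fun f => (f.hom.right : a.obj.right ⟶ b.obj.right)) (by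
        intro f g h
        apply ObjectProperty.hom_ext
        exact Under.UnderMorphism.ext h)
    exact Fintype.ofFinite _

variable {C : Type u} [Category.{v} C]

section Reedy

/-- The diagram whose colimit is the `n`-th latching object of `Q`. -/
abbrev latchingDiagram (Q : SimplexCategory ⥤ C) (n : ℕ) : LatchingIndex n ⥤ C :=
  (isLatchingIndex n).ι ⋙ Over.forget ⦋n⦌ ⋙ Q

/-- The cocone with point `Qⁿ` given by the maps `Qᵏ ⟶ Qⁿ`. -/
abbrev latchingCocone (Q : SimplexCategory ⥤ C) (n : ℕ) : Cocone (latchingDiagram Q n) where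
  pt := Q.obj ⦋n⦌
  ι :=
    { app := fun k => Q.map k.obj.hom
      naturality := fun k l g => by
        have h := Over.w g.hom
        dsimp at h ⊢
        rw [Category.comp_id, ← h, Q.map_comp] }

/-- The latching map `Lⁿ Q ⟶ Qⁿ`. -/
noncomputable def latchingMap [HasFiniteColimits C] (Q : SimplexCategory ⥤ C) (n : ℕ) :
    colimit (latchingDiagram Q n) ⟶ Q.obj ⦋n⦌ :=
  colimit.desc _ (latchingCocone Q n)

/-- The diagram whose limit is the `n`-th matching object of `Q`. -/
abbrev matchingDiagram (Q : SimplexCategory ⥤ C) (n : ℕ) : MatchingIndex n ⥤ C :=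
  (isMatchingIndex n).ι ⋙ Under.forget ⦋n⦌ ⋙ Q

/-- The cone with point `Qⁿ` given by the maps `Qⁿ ⟶ Qᵏ`. -/
abbrev matchingCone (Q : SimplexCategory ⥤ C) (n : ℕ) : Cone (matchingDiagram Q n) where
  pt := Q.obj ⦋n⦌
  π :=
    { app := fun k => Q.map k.obj.hom
      naturality := fun k l g => by
        have h := Under.w g.hom
        dsimp at h ⊢
        rw [Category.id_comp, ← h, Q.map_comp] }

/-- The matching map `Qⁿ ⟶ Mⁿ Q`. -/
noncomputable def matchingMap [HasFiniteLimits C] (Q : SimplexCategory ⥤ C) (n : ℕ) :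
    Q.obj ⦋n⦌ ⟶ limit (matchingDiagram Q n) :=
  limit.lift _ (matchingCone Q n)

/-- The map `Mⁿ Q ⟶ Mⁿ R` induced by `p : Q ⟶ R`. -/
noncomputable def matchingObjMap [HasFiniteLimits C] {Q R : SimplexCategory ⥤ C} (p : Q ⟶ R)
    (n : ℕ) : limit (matchingDiagram Q n) ⟶ limit (matchingDiagram R n) :=
  limMap (Functor.whiskerLeft (isMatchingIndex n).ι (Functor.whiskerLeft (Under.forget ⦋n⦌) p))

lemma matchingMap_naturality [HasFiniteLimits C] {Q R : SimplexCategory ⥤ C} (p : Q ⟶ R)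
    (n : ℕ) : p.app ⦋n⦌ ≫ matchingMap R n = matchingMap Q n ≫ matchingObjMap p n := by
  apply limit.hom_ext
  intro k
  simp only [matchingMap, matchingObjMap, Category.assoc, limit.lift_π, limMap_π,
    limit.lift_π_assoc]
  exact (p.naturality k.obj.hom).symm

/-- The relative matching map `Qⁿ ⟶ Rⁿ ×_{Mⁿ R} Mⁿ Q` of `p : Q ⟶ R`. -/
noncomputable def relativeMatchingMap [HasFiniteLimits C] {Q R : SimplexCategory ⥤ C}
    (p : Q ⟶ R) (n : ℕ) : Q.obj ⦋n⦌ ⟶ pullback (matchingMap R n) (matchingObjMap p n) :=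
  pullback.lift (p.app ⦋n⦌) (matchingMap Q n) (matchingMap_naturality p n)

variable [ModelCategory C]

/-- Cofibrant objects of the Reedy model structure on cosimplicial objects. -/
def IsReedyCofibrant (Q : SimplexCategory ⥤ C) : Prop :=
  ∀ n : ℕ, cofibrations C (latchingMap Q n)

/-- Trivial fibrations of the Reedy model structure on cosimplicial objects: all relative matching
maps are trivial fibrations. -/
def IsReedyTrivialFibration {Q R : SimplexCategory ⥤ C} (p : Q ⟶ R) : Prop :=
  ∀ n : ℕ, trivialFibrations C (relativeMatchingMap p n)

/-- A cosimplicial resolution of `A`: a cofibrant replacement of the constant cosimplicial object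
on `A` in the Reedy model structure, i.e. a Reedy cofibrant cosimplicial object with a
Reedy trivial fibration to the constant one. -/
structure CosimplicialResolution (A : C) where
  /-- the underlying cosimplicial object -/
  obj : SimplexCategory ⥤ C
  /-- the augmentation -/
  aug : obj ⟶ (Functor.const SimplexCategory).obj A
  cofibrant : IsReedyCofibrant obj
  trivialFibration : IsReedyTrivialFibration aug

end Reedy

/-! ### Homotopy mapping spaces and local objects -/

section MappingSpaces

variable [ModelCategory C]

open Classical in
/-- A fibrant replacement of `X`; as is customary, a fibrant object is its own replacement. -/
noncomputable def fibrantReplacement (X : C) : C :=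
  if IsFibrant X then X else
    (MorphismProperty.factorizationData (trivialCofibrations C) (fibrations C)
      (terminal.from X)).Z

/-- The simplicial set `n ↦ Hom(Qⁿ, Y)`. -/
abbrev homComplex (Q : SimplexCategory ⥤ C) (Y : C) : SSet.{v} :=
  Q.op ⋙ yoneda.obj Y

/-- Precomposition with `φ : P ⟶ Q` on `homComplex`. -/
abbrev homComplexMap {P Q : SimplexCategory ⥤ C} (φ : P ⟶ Q) (Y : C) :
    homComplex Q Y ⟶ homComplex P Y :=
  Functor.whiskerRight (NatTrans.op φ) (yoneda.obj Y)

/-- The homotopy mapping space of `A` and `X`, as an object of `Ho(SSet)`, computed from a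
cosimplicial resolution of `A`. -/
noncomputable abbrev homotopyMappingSpace {A : C} (P : CosimplicialResolution A) (X : C) :
    HoSSet.{v} :=
  toHoSSet.obj (homComplex P.obj (fibrantReplacement X))

/-- The map of homotopy mapping spaces induced by a map of cosimplicial resolutions. -/
noncomputable abbrev homotopyMappingSpaceMap {A B : C} (P : CosimplicialResolution A)
    (Q : CosimplicialResolution B) (φ : P.obj ⟶ Q.obj) (X : C) :
    homotopyMappingSpace Q X ⟶ homotopyMappingSpace P X :=
  toHoSSet.map (homComplexMap φ (fibrantReplacement X))

/-- For `f : A ⟶ B`, the induced map from the homotopy mapping space of `B` and `X` to that of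
`A` and `X` is an isomorphism in `Ho(SSet)`. It is computed from a lift of `f` to
cosimplicial resolutions of `A` and `B`; these choices always exist, and the property does not
depend on them. -/
def IsIsoOnMappingSpaces {A B : C} (f : A ⟶ B) (X : C) : Prop :=
  ∃ (P : CosimplicialResolution A) (Q : CosimplicialResolution B) (φ : P.obj ⟶ Q.obj),
    φ ≫ Q.aug = P.aug ≫ (Functor.const SimplexCategory).map f ∧
      IsIso (homotopyMappingSpaceMap P Q φ X)

/-- `X` is local with respect to the class `S`. -/
def IsLocal (S : MorphismProperty C) (X : C) : Prop :=
  ∀ ⦃A B : C⦄ (f : A ⟶ B), S f → IsIsoOnMappingSpaces f X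

/-- `f` is an `S`-equivalence. -/
def IsLocalEquivalence (S : MorphismProperty C) {A B : C} (f : A ⟶ B) : Prop :=
  ∀ X : C, IsLocal S X → IsIsoOnMappingSpaces f X

end MappingSpaces

/-! ### Bousfield localisations

A category may carry several model structures, so they are explicit terms here. -/

/-- The cofibrations of a model structure. -/
abbrev Cof (M : ModelCategory C) : MorphismProperty C := cofibrations C

/-- The weak equivalences of a model structure. -/
abbrev Weq (M : ModelCategory C) : MorphismProperty C := weakEquivalences C

/-- The fibrant objects of a model structure. -/
abbrev Fibrant (M : ModelCategory C) (X : C) : Prop := IsFibrant X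

/-- `L` is a left Bousfield localisation of `M`. -/
structure IsBousfieldLocalisation (M L : ModelCategory C) : Prop where
  cof_eq : Cof L = Cof M
  weq_le : Weq M ≤ Weq L

/-- `L` is the Bousfield localisation of `M` with respect to the class `S`: its fibrant objects are
the `S`-local fibrant objects of `M`, and its weak equivalences are the `S`-equivalences. -/
structure IsLocalisation (M : ModelCategory C) (S : MorphismProperty C) (L : ModelCategory C) :
    Prop extends IsBousfieldLocalisation M L where
  fibrant_iff : ∀ X : C, Fibrant L X ↔ Fibrant M X ∧ @IsLocal C _ M S X
  weq_iff : ∀ ⦃A B : C⦄ (f : A ⟶ B), Weq L f ↔ @IsLocalEquivalence C _ M S A B f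

end BousfieldLocalisation

namespace BousfieldLocalisation

section SingleModelStructure

variable {C : Type u} [Category.{v} C] [ModelCategory C]

/-! Left Bousfield localisation keeps the cofibrations, hence also the trivial fibrations, which are
the maps lifting against them. Cosimplicial resolutions involve nothing else, so an object fibrant
in two of the model structures has the same mapping spaces in both. Hence the fibrant objects after
localising in two steps are the fibrant objects of `M` that are both `S`-local and `T`-local
(`isLocal_sup_iff`). These suffice to test weak equivalences (`isLocalEquivalence_iff`), so the weak
equivalences agree too, and `modelCategory_eq` concludes. -/

lemma rlp_cofibrations : (cofibrations C).rlp = trivialFibrations C :=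
  cofibrations_rlp C

lemma rlp_trivialCofibrations : (trivialCofibrations C).rlp = fibrations C :=
  trivialCofibrations_rlp C

lemma fibrantReplacement_of_isFibrant {X : C} (hX : IsFibrant X) : fibrantReplacement X = X :=
  if_pos hX

lemma isFibrant_fibrantReplacement (X : C) : IsFibrant (fibrantReplacement X) := by
  unfold fibrantReplacement
  split_ifs with hX
  · exact hX
  · let d := MorphismProperty.factorizationData (trivialCofibrations C) (fibrations C)
      (terminal.from X)
    exact (isFibrant_iff_of_isTerminal d.p terminalIsTerminal).2 ((fibration_iff _).2 d.hp)

lemma isIsoOnMappingSpaces_congr {A B : C} (f : A ⟶ B) {X Y : C}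
    (h : fibrantReplacement X = fibrantReplacement Y) :
    IsIsoOnMappingSpaces f X ↔ IsIsoOnMappingSpaces f Y := by
  unfold IsIsoOnMappingSpaces homotopyMappingSpaceMap homotopyMappingSpace
  rw [h]

/-- Since a fibrant object is its own replacement, fibrant replacement is strictly idempotent; no
homotopy invariance is needed. -/
lemma isIsoOnMappingSpaces_fibrantReplacement_iff {A B : C} (f : A ⟶ B) (X : C) :
    IsIsoOnMappingSpaces f (fibrantReplacement X) ↔ IsIsoOnMappingSpaces f X :=
  isIsoOnMappingSpaces_congr f
    (fibrantReplacement_of_isFibrant (isFibrant_fibrantReplacement X))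

lemma isLocal_fibrantReplacement_iff (S : MorphismProperty C) (X : C) :
    IsLocal S (fibrantReplacement X) ↔ IsLocal S X := by
  simp only [IsLocal, isIsoOnMappingSpaces_fibrantReplacement_iff]

lemma isLocal_sup_iff (S T : MorphismProperty C) (X : C) :
    IsLocal (S ⊔ T) X ↔ IsLocal S X ∧ IsLocal T X :=
  ⟨fun h => ⟨fun _ _ f hf => h f (Or.inl hf), fun _ _ f hf => h f (Or.inr hf)⟩,
    fun h _ _ f hf => hf.elim (h.1 f) (h.2 f)⟩

/-- Local equivalences are detected by the fibrant local objects. -/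
lemma isLocalEquivalence_iff (S : MorphismProperty C) {A B : C} (f : A ⟶ B) :
    IsLocalEquivalence S f ↔
      ∀ X : C, IsFibrant X → IsLocal S X → IsIsoOnMappingSpaces f X :=
  ⟨fun h X _ hX => h X hX, fun h X hX =>
    (isIsoOnMappingSpaces_fibrantReplacement_iff f X).1
      (h _ (isFibrant_fibrantReplacement X) ((isLocal_fibrantReplacement_iff S X).2 hX))⟩

end SingleModelStructure

section Comparison

variable {C : Type u} [Category.{v} C]

lemma trivialFibrations_eq_of_cof_eq {M L : ModelCategory C} (h : Cof L = Cof M) :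
    @trivialFibrations C _ L.categoryWithFibrations L.categoryWithWeakEquivalences =
      @trivialFibrations C _ M.categoryWithFibrations M.categoryWithWeakEquivalences := by
  have hL := @rlp_cofibrations C _ L
  have hM := @rlp_cofibrations C _ M
  exact hL.symm.trans ((congrArg MorphismProperty.rlp h).trans hM)

/-- Cosimplicial resolutions depend only on the cofibrations of the model structure. -/
def CosimplicialResolution.ofCofEq {M L : ModelCategory C} (h : Cof L = Cof M) {A : C}
    (P : @CosimplicialResolution C _ L A) : @CosimplicialResolution C _ M A :=
  @CosimplicialResolution.mk C _ M A
    (@CosimplicialResolution.obj C _ L A P) (@CosimplicialResolution.aug C _ L A P)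
    -- The existence of finite limits and colimits is a proposition, so both structures give
    -- definitionally the same latching and relative matching maps.
    (fun n => h.le _ (@CosimplicialResolution.cofibrant C _ L A P n))
    (fun n => (trivialFibrations_eq_of_cof_eq h).le _
      (@CosimplicialResolution.trivialFibration C _ L A P n))

lemma IsIsoOnMappingSpaces.of_cof_eq {M L : ModelCategory C} (h : Cof L = Cof M) {A B : C}
    {f : A ⟶ B} {X : C}
    (hX : @fibrantReplacement C _ L X = @fibrantReplacement C _ M X)
    (H : @IsIsoOnMappingSpaces C _ L A B f X) : @IsIsoOnMappingSpaces C _ M A B f X := by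
  obtain ⟨P, Q, φ, hφ, hiso⟩ := H
  refine ⟨.ofCofEq h P, .ofCofEq h Q, φ, hφ, ?_⟩
  unfold homotopyMappingSpaceMap homotopyMappingSpace at hiso ⊢
  rw [hX] at hiso
  exact hiso

/-- Fibrancy in both structures makes both replacements equal to `X`; for other objects they may
differ. -/
lemma isIsoOnMappingSpaces_iff_of_cof_eq {M L : ModelCategory C} (h : Cof L = Cof M) {A B : C}
    (f : A ⟶ B) {X : C} (hL : Fibrant L X) (hM : Fibrant M X) :
    @IsIsoOnMappingSpaces C _ L A B f X ↔ @IsIsoOnMappingSpaces C _ M A B f X := by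
  have hX : @fibrantReplacement C _ L X = @fibrantReplacement C _ M X :=
    (@fibrantReplacement_of_isFibrant C _ L X hL).trans
      (@fibrantReplacement_of_isFibrant C _ M X hM).symm
  exact ⟨.of_cof_eq h hX, .of_cof_eq h.symm hX.symm⟩

lemma isLocal_iff_of_cof_eq {M L : ModelCategory C} (h : Cof L = Cof M)
    (S : MorphismProperty C) {X : C} (hL : Fibrant L X) (hM : Fibrant M X) :
    @IsLocal C _ L S X ↔ @IsLocal C _ M S X :=
  forall₄_congr fun _ _ f _ => isIsoOnMappingSpaces_iff_of_cof_eq h f hL hM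

/-- A model structure is determined by its cofibrations and its weak equivalences. -/
lemma modelCategory_eq {M L : ModelCategory C} (hc : Cof L = Cof M) (hw : Weq L = Weq M) :
    L = M := by
  have hf : @fibrations C _ L.categoryWithFibrations =
      @fibrations C _ M.categoryWithFibrations := by
    have hL := @rlp_trivialCofibrations C _ L
    have hM := @rlp_trivialCofibrations C _ M
    exact hL.symm.trans ((congrArg MorphismProperty.rlp (congrArg₂ (· ⊓ ·) hc hw)).trans hM)
  -- Beyond the three classes of maps, a model structure consists of propositions.
  obtain ⟨⟨_⟩, ⟨_⟩, ⟨_⟩⟩ := L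
  obtain ⟨⟨_⟩, ⟨_⟩, ⟨_⟩⟩ := M
  dsimp only [Cof, Weq, cofibrations, weakEquivalences, fibrations] at hc hw hf
  subst hc hw hf
  rfl

/-- Localising in two steps is the same as localising at the union. -/
lemma IsLocalisation.eq_of_sup {M L_S L L' : ModelCategory C} {S T : MorphismProperty C}
    (hS : IsLocalisation M S L_S) (hTS : IsLocalisation L_S T L)
    (hU : IsLocalisation M (S ⊔ T) L') : L = L' := by
  -- The two sides describe the fibrant objects of `L` and `L'`. An object fibrant in `L_S` is
  -- fibrant in `M`, so `T`-locality means the same in both.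
  have key (X : C) : Fibrant L_S X ∧ @IsLocal C _ L_S T X ↔
      Fibrant M X ∧ @IsLocal C _ M (S ⊔ T) X := by
    rw [@isLocal_sup_iff C _ M, ← and_assoc, ← hS.fibrant_iff]
    exact and_congr_right fun hX =>
      isLocal_iff_of_cof_eq hS.cof_eq T hX ((hS.fibrant_iff X).1 hX).1
  refine modelCategory_eq (hTS.cof_eq.trans (hS.cof_eq.trans hU.cof_eq.symm)) ?_
  ext A B f
  -- Restricting to fibrant test objects is what allows mapping spaces in `L_S` and `M` to be
  -- compared.
  rw [hTS.weq_iff, hU.weq_iff, @isLocalEquivalence_iff C _ L_S, @isLocalEquivalence_iff C _ M]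
  refine forall_congr' fun X => ?_
  rw [← and_imp, ← and_imp]
  constructor
  · intro H hX
    have hX' := (key X).2 hX
    exact (isIsoOnMappingSpaces_iff_of_cof_eq hS.cof_eq f hX'.1 hX.1).1 (H hX')
  · intro H hX
    have hX' := (key X).1 hX
    exact (isIsoOnMappingSpaces_iff_of_cof_eq hS.cof_eq f hX.1 hX'.1).2 (H hX')

end Comparison

end BousfieldLocalisation

theorem mainTheorem8 {C : Type u} [Category.{v} C] (M : ModelCategory C)
    (S T : MorphismProperty C) (L_S L_T L_TL_S L_SL_T L_ST : ModelCategory C)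
    (hS : BousfieldLocalisation.IsLocalisation M S L_S)
    (hT : BousfieldLocalisation.IsLocalisation M T L_T)
    (hTS : BousfieldLocalisation.IsLocalisation L_S T L_TL_S)
    (hST : BousfieldLocalisation.IsLocalisation L_T S L_SL_T)
    (hU : BousfieldLocalisation.IsLocalisation M (S ⊔ T) L_ST) :
    L_TL_S = L_ST ∧ L_SL_T = L_ST :=
  ⟨hS.eq_of_sup hTS hU, hT.eq_of_sup hST (sup_comm S T ▸ hU)⟩
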